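/- The Horton--Strahler number $\operatorname{HS}$ of a binary tree is that of its root, where $\operatorname{HS}(v)=0$ for a leaf $v$, $\operatorname{HS}(v)=\operatorname{HS}(w)$ if $v$ has exactly one child $w$, and $\operatorname{HS}(v)=\max(\operatorname{HS}(v_\ell),\operatorname{HS}(v_r))+\mathbf 1_{\operatorname{HS}(v_\ell)=\operatorname{HS}(v_r)}$ if $v$ has two children $v_\ell,v_r$. For $n\ge 0$ let $N=2^n$. A simple butterfly permutation of length $N$ is one of the $N$ Kronecker products $\tau^{k_1}\otimes\cdots\otimes\tau^{k_n}$ with $k_j\in\{0,1\}$ and $\tau=(1\ 2)$, where the Kronecker product of permutations is the one given by the Kronecker product of their permutation matrices. A simple butterfly tree with $N$ nodes is the binary search tree obtained by inserting successively the keys $\pi(1),\dots,\pi(N)$ of a simple butterfly permutation $\pi$; the uniform simple butterfly tree $\mathcal T_n$ is the one with $\pi$ uniformly distributed over all simple butterfly permutations of length $N$. Every simple butterfly tree with $N$ nodes has Horton--Strahler number at most $\lfloor\log_4 N\rfloor$, and \[ \mathbb E[\operatorname{HS}(\mathcal T_n)]=\log_8 N+O(1),\qquad \operatorname{Var}(\operatorname{HS}(\mathcal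 T_n))=\tfrac29\log_8 N+O(1). \] Moreover, as $n\to\infty$, \[ \frac{\operatorname{HS}(\mathcal T_n)}{\log_8 N}\to 1\quad\text{in probability and in } L^r \text{ for every real } r\ge 1,\qquad \frac{\operatorname{HS}(\mathcal T_n)-\mathbb E[\operatorname{HS}(\mathcal T_n)]}{\sqrt{\operatorname{Var}(\operatorname{HS}(\mathcal T_n))}}\to \mathcal N(0,1)\quad\text{in distribution}. \] -/

import Mathlib

open MeasureTheory ProbabilityTheory Filter Topology

namespace Butterfly

/-! ### Binary search trees and the Horton–Strahler number -/

/-- Insertion of the key `k` into a binary search tree: smaller keys go to the left, larger keys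
to the right, and a key that is already present is not inserted again. -/
def insertKey {α : Type*} [LinearOrder α] (k : α) : BinaryTree α → BinaryTree α
  | .nil => .node k .nil .nil
  | .node a l r =>
      if k < a then .node a (insertKey k l) r
      else if a < k then .node a l (insertKey k r)
      else .node a l r

/-- The binary search tree obtained by inserting the keys of a list, from first to last, into the
empty tree. -/
def bstOfList {α : Type*} [LinearOrder α] (w : List α) : BinaryTree α :=
  w.foldl (fun t k => insertKey k t) .nil

/-- The binary search tree `𝒯(π)` of a permutation: its keys `π 0, π 1, …` are inserted in this
order. -/
def bst {m : ℕ} (π : Equiv.Perm (Fin m)) : BinaryTree (Fin m) :=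
  bstOfList (List.ofFn π)

/-- The Horton–Strahler number of (the root of) a binary tree. A leaf, i.e. a node without
children, has number `0`; a node with a single child inherits the number of that child; a node with
two children takes the maximum of their numbers, plus one if these are equal.
(The empty tree, which has no root, gets the value `0` by convention.) -/
def hs {α : Type*} : BinaryTree α → ℕ
  | .nil => 0
  | .node _ .nil .nil => 0
  | .node _ (.node a l r) .nil => hs (.node a l r)
  | .node _ .nil (.node b l' r') => hs (.node b l' r')
  | .node _ (.node a l r) (.node b l' r') =>
      max (hs (.node a l r)) (hs (.node b l' r')) +
        if hs (.node a l r) = hs (.node b l' r') then 1 else 0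

/-! ### Simple butterfly permutations -/

/-- The Kronecker product of two permutations, `(σ ⊗ τ) (b * i + j) = b * σ i + τ j`; its
permutation matrix is the Kronecker product of the permutation matrices of `σ` and `τ`. -/
def kron {a b : ℕ} (σ : Equiv.Perm (Fin a)) (τ : Equiv.Perm (Fin b)) :
    Equiv.Perm (Fin (a * b)) :=
  finProdFinEquiv.permCongr (Equiv.prodCongr σ τ)

/-- The set of simple butterfly permutations of length `N = 2 ^ n`: all the `n`-fold Kronecker
products `τ ^ k₁ ⊗ ⋯ ⊗ τ ^ kₙ` with `k₁, …, kₙ ∈ {0, 1}`, where `τ` is the transposition of two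
points. -/
def simpleButterfly : (n : ℕ) → Set (Equiv.Perm (Fin (2 ^ n)))
  | 0 => {1}
  | n + 1 => {σ | ∃ k : Fin 2, ∃ π ∈ simpleButterfly n,
      σ = (finCongr (pow_succ' 2 n).symm).permCongr
        (kron ((Equiv.swap (0 : Fin 2) 1) ^ (k : ℕ)) π)}

/-- Every set of permutations of the finite set `Fin m` is measurable. -/
instance instMeasurableSpacePermFin (m : ℕ) : MeasurableSpace (Equiv.Perm (Fin m)) := ⊤

end Butterfly

/-! Prepending a Kronecker factor to a permutation attaches to its tree a translated copy of that
tree, at the end of the right spine (factor `1`) or of the left spine (factor `τ`); see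
`bst_extend_zero` and `bst_extend_one`. Three shapes are closed under these operations. A balanced
tree becomes heavy on the chosen side, with the same Horton–Strahler number. A heavy tree stays as
it is if the copy goes to its heavy side; otherwise it becomes balanced and the number grows by one.
Hence each increment costs at least two factors, which gives the bound `n / 2`. For uniform factors
the increments form a renewal process with waiting time one plus a geometric variable of mean 2, so
mean 3 and variance 2, whence the rates `1 / 3` and `2 / 27`.

The proof extracts from this only the second-order recursion `hsMean_add_two`. It yields the first
two moments and, through `hsMean_pow`, the generating function in closed form. The second moment and
the bound `n / 2` give convergence in probability and in `L ^ r`; the dominant characteristic root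
gives the limit of the characteristic functions. -/

namespace Butterfly

/-! ### The Strahler number with value `0` on the empty tree -/

/-- The Strahler number of a node whose subtrees have Strahler numbers `a` and `b`. -/
def combine (a b : ℕ) : ℕ := max a b + if a = b then 1 else 0

/-- The Strahler number of a binary tree, normalized by the value `0` on the empty tree. -/
def strahler {α : Type*} : BinaryTree α → ℕ
  | .nil => 0
  | .node _ l r => combine (strahler l) (strahler r)

/-- The Strahler number of the tree obtained by attaching a tree with Strahler number `x` at the
end of the right spine, as a function of `x`. -/
def rightSpine {α : Type*} : BinaryTree α → ℕ → ℕ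
  | .nil, x => x
  | .node _ l r, x => combine (strahler l) (rightSpine r x)

/-- The Strahler number of the tree obtained by attaching a tree with Strahler number `x` at the
end of the left spine, as a function of `x`. -/
def leftSpine {α : Type*} : BinaryTree α → ℕ → ℕ
  | .nil, x => x
  | .node _ l r, x => combine (leftSpine l x) (strahler r)

/-- Attach the tree `s` at the end of the right spine of a tree. -/
def appendRight {α : Type*} (s : BinaryTree α) : BinaryTree α → BinaryTree α
  | .nil => s
  | .node a l r => .node a l (appendRight s r)

/-- Attach the tree `s` at the end of the left spine of a tree. -/
def appendLeft {α : Type*} (s : BinaryTree α) : BinaryTree α → BinaryTree α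
  | .nil => s
  | .node a l r => .node a (appendLeft s l) r

section Trees

variable {α β : Type*}

lemma combine_pos (a b : ℕ) : 0 < combine a b := by grind [combine]

lemma combine_self (a : ℕ) : combine a a = a + 1 := by grind [combine]

lemma combine_of_lt {a b : ℕ} (h : a < b) : combine a b = b := by grind [combine]

lemma combine_of_gt {a b : ℕ} (h : b < a) : combine a b = a := by grind [combine]

lemma le_combine_left (a b : ℕ) : a ≤ combine a b := by grind [combine]

lemma le_combine_right (a b : ℕ) : b ≤ combine a b := by grind [combine]

lemma combine_sub_one {a b : ℕ} (ha : 0 < a) (hb : 0 < b) :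
    combine (a - 1) (b - 1) = combine a b - 1 := by grind [combine]

/-- With value 0 on the empty tree and 1 on leaves, a single rule `combine` covers all nodes: a
missing child is always dominated by a present one. -/
lemma hs_eq_strahler_sub_one (t : BinaryTree α) : hs t = strahler t - 1 := by
  induction t using hs.induct with
  | case1 => simp [hs, strahler]
  | case2 => simp [hs, strahler, combine]
  | case3 a b l r ih =>
    have := combine_pos (strahler l) (strahler r)
    rw [hs, ih]
    simp only [strahler]
    rw [combine_of_gt this]
  | case4 a b l r ih =>
    have := combine_pos (strahler l) (strahler r)
    rw [hs, ih]
    simp only [strahler]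
    rw [combine_of_lt this]
  | case5 a b l r c l' r' ih1 ih2 =>
    have := combine_pos (strahler l) (strahler r)
    have := combine_pos (strahler l') (strahler r')
    rw [hs, ih1, ih2]
    exact combine_sub_one ‹_› ‹_›

lemma strahler_map (f : α → β) (t : BinaryTree α) : strahler (t.map f) = strahler t := by
  induction t with
  | nil => rfl
  | node a l r hl hr => simp [BinaryTree.map, strahler, hl, hr]

lemma rightSpine_map (f : α → β) (t : BinaryTree α) (x : ℕ) :
    rightSpine (t.map f) x = rightSpine t x := by
  induction t with
  | nil => rfl
  | node a l r _ hr => simp [BinaryTree.map, rightSpine, strahler_map, hr]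

lemma leftSpine_map (f : α → β) (t : BinaryTree α) (x : ℕ) :
    leftSpine (t.map f) x = leftSpine t x := by
  induction t with
  | nil => rfl
  | node a l r hl _ => simp [BinaryTree.map, leftSpine, strahler_map, hl]

lemma appendRight_nil (t : BinaryTree α) : appendRight .nil t = t := by
  induction t with
  | nil => rfl
  | node a l r _ hr => rw [appendRight, hr]

lemma appendLeft_nil (t : BinaryTree α) : appendLeft .nil t = t := by
  induction t with
  | nil => rfl
  | node a l r hl _ => rw [appendLeft, hl]

lemma strahler_appendRight (s t : BinaryTree α) :
    strahler (appendRight s t) = rightSpine t (strahler s) := by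
  induction t with
  | nil => rfl
  | node a l r _ hr => simp [appendRight, strahler, rightSpine, hr]

lemma strahler_appendLeft (s t : BinaryTree α) :
    strahler (appendLeft s t) = leftSpine t (strahler s) := by
  induction t with
  | nil => rfl
  | node a l r hl _ => simp [appendLeft, strahler, leftSpine, hl]

lemma rightSpine_appendRight (s t : BinaryTree α) (x : ℕ) :
    rightSpine (appendRight s t) x = rightSpine t (rightSpine s x) := by
  induction t with
  | nil => rfl
  | node a l r _ hr => simp [appendRight, rightSpine, hr]

lemma leftSpine_appendLeft (s t : BinaryTree α) (x : ℕ) :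
    leftSpine (appendLeft s t) x = leftSpine t (leftSpine s x) := by
  induction t with
  | nil => rfl
  | node a l r hl _ => simp [appendLeft, leftSpine, hl]

/-- Every subtree hanging off the spine has a number below `x`, so `x` travels up to the root
unchanged. -/
lemma rightSpine_of_lt {t : BinaryTree α} {x : ℕ} (h : strahler t < x) : rightSpine t x = x := by
  induction t with
  | nil => rfl
  | node a l r _ hr =>
    have h1 := le_combine_left (strahler l) (strahler r)
    have h2 := le_combine_right (strahler l) (strahler r)
    rw [strahler] at h
    rw [rightSpine, hr (by omega), combine_of_lt (by omega)]

lemma leftSpine_of_lt {t : BinaryTree α} {x : ℕ} (h : strahler t < x) : leftSpine t x = x := by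
  induction t with
  | nil => rfl
  | node a l r hl _ =>
    have h1 := le_combine_left (strahler l) (strahler r)
    have h2 := le_combine_right (strahler l) (strahler r)
    rw [strahler] at h
    rw [leftSpine, hl (by omega), combine_of_gt (by omega)]

/-! ### The three shapes of a simple butterfly tree -/

/-- Both subtrees of the root have Strahler number `m`. -/
def Balanced (m : ℕ) : BinaryTree α → Prop
  | .nil => False
  | .node _ l r => strahler l = m ∧ strahler r = m

/-- The left and right subtrees of the root have Strahler numbers `m` and `m + 1`, and attaching
a tree with Strahler number `m + 1` at the end of the right spine does not change the latter. -/
def RightHeavy (m : ℕ) : BinaryTree α → Prop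
  | .nil => False
  | .node _ l r => strahler l = m ∧ strahler r = m + 1 ∧ rightSpine r (m + 1) = m + 1

/-- The mirror image of `RightHeavy`. -/
def LeftHeavy (m : ℕ) : BinaryTree α → Prop
  | .nil => False
  | .node _ l r => strahler r = m ∧ strahler l = m + 1 ∧ leftSpine l (m + 1) = m + 1

variable {m : ℕ} {t : BinaryTree α}

lemma Balanced.strahler_eq (h : Balanced m t) : strahler t = m + 1 := by
  cases t with
  | nil => exact h.elim
  | node a l r => rw [strahler, h.1, h.2, combine_self]

lemma RightHeavy.strahler_eq (h : RightHeavy m t) : strahler t = m + 1 := by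
  cases t with
  | nil => exact h.elim
  | node a l r => rw [strahler, h.1, h.2.1, combine_of_lt m.lt_succ_self]

lemma LeftHeavy.strahler_eq (h : LeftHeavy m t) : strahler t = m + 1 := by
  cases t with
  | nil => exact h.elim
  | node a l r => rw [strahler, h.1, h.2.1, combine_of_gt m.lt_succ_self]

variable (f g : α → β)

lemma Balanced.appendRight (h : Balanced m t) :
    RightHeavy m (appendRight (t.map g) (t.map f)) := by
  have hs := h.strahler_eq
  cases t with
  | nil => exact h.elim
  | node a l r =>
    obtain ⟨h1, h2⟩ := h
    have h3 : rightSpine r (m + 1) = m + 1 := rightSpine_of_lt (by omega)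
    refine ⟨by rw [strahler_map, h1], ?_, ?_⟩
    · rw [strahler_appendRight, strahler_map, hs, rightSpine_map, h3]
    · rw [rightSpine_appendRight, rightSpine_map, rightSpine_map, rightSpine, h3, h1,
        combine_of_lt m.lt_succ_self, h3]

lemma Balanced.appendLeft (h : Balanced m t) :
    LeftHeavy m (appendLeft (t.map g) (t.map f)) := by
  have hs := h.strahler_eq
  cases t with
  | nil => exact h.elim
  | node a l r =>
    obtain ⟨h1, h2⟩ := h
    have h3 : leftSpine l (m + 1) = m + 1 := leftSpine_of_lt (by omega)
    refine ⟨by rw [strahler_map, h2], ?_, ?_⟩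
    · rw [strahler_appendLeft, strahler_map, hs, leftSpine_map, h3]
    · rw [leftSpine_appendLeft, leftSpine_map, leftSpine_map, leftSpine, h3, h2,
        combine_of_gt m.lt_succ_self, h3]

/-- Attaching along right spines composes the functions `rightSpine`, so the fixed point `m + 1`
required by `RightHeavy` survives. -/
lemma RightHeavy.appendRight (h : RightHeavy m t) :
    RightHeavy m (appendRight (t.map g) (t.map f)) := by
  have hs := h.strahler_eq
  cases t with
  | nil => exact h.elim
  | node a l r =>
    obtain ⟨h1, h2, h3⟩ := h
    refine ⟨by rw [strahler_map, h1], ?_, ?_⟩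
    · rw [strahler_appendRight, strahler_map, hs, rightSpine_map, h3]
    · rw [rightSpine_appendRight, rightSpine_map, rightSpine_map, rightSpine, h3, h1,
        combine_of_lt m.lt_succ_self, h3]

lemma LeftHeavy.appendLeft (h : LeftHeavy m t) :
    LeftHeavy m (appendLeft (t.map g) (t.map f)) := by
  have hs := h.strahler_eq
  cases t with
  | nil => exact h.elim
  | node a l r =>
    obtain ⟨h1, h2, h3⟩ := h
    refine ⟨by rw [strahler_map, h1], ?_, ?_⟩
    · rw [strahler_appendLeft, strahler_map, hs, leftSpine_map, h3]
    · rw [leftSpine_appendLeft, leftSpine_map, leftSpine_map, leftSpine, h3, h1,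
        combine_of_gt m.lt_succ_self, h3]

/-- The copy, of number `m + 1`, dominates the light left subtree and lifts it to the level of the
right one. -/
lemma RightHeavy.appendLeft (h : RightHeavy m t) :
    Balanced (m + 1) (appendLeft (t.map g) (t.map f)) := by
  have hs := h.strahler_eq
  cases t with
  | nil => exact h.elim
  | node a l r =>
    obtain ⟨h1, h2, -⟩ := h
    refine ⟨?_, by rw [strahler_map, h2]⟩
    rw [strahler_appendLeft, strahler_map, hs, leftSpine_map, leftSpine_of_lt (by omega)]

lemma LeftHeavy.appendRight (h : LeftHeavy m t) :
    Balanced (m + 1) (appendRight (t.map g) (t.map f)) := by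
  have hs := h.strahler_eq
  cases t with
  | nil => exact h.elim
  | node a l r =>
    obtain ⟨h1, h2, -⟩ := h
    refine ⟨by rw [strahler_map, h2], ?_⟩
    rw [strahler_appendRight, strahler_map, hs, rightSpine_map, rightSpine_of_lt (by omega)]

end Trees

/-! ### Insertion of blocks of keys -/

section Insertion

variable {α β γ : Type*} [LinearOrder α] [LinearOrder β]

lemma insertKey_map {f : α → β} (hf : StrictMono f) (k : α) (t : BinaryTree α) :
    insertKey (f k) (t.map f) = (insertKey k t).map f := by
  induction t with
  | nil => rfl
  | node a l r hl hr =>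
    simp only [BinaryTree.map, insertKey, hf.lt_iff_lt, hl, hr]
    split_ifs <;> rfl

lemma foldl_insertKey_map {f : α → β} (hf : StrictMono f) (w : List α) (t : BinaryTree α) :
    (w.map f).foldl (fun t k => insertKey k t) (t.map f) =
      (w.foldl (fun t k => insertKey k t) t).map f := by
  induction w generalizing t with
  | nil => rfl
  | cons a w ih => simp only [List.map_cons, List.foldl_cons, insertKey_map hf, ih]

lemma bstOfList_map {f : α → β} (hf : StrictMono f) (w : List α) :
    bstOfList (w.map f) = (bstOfList w).map f :=
  foldl_insertKey_map hf w .nil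

/-- A key above all keys of `t` runs down the whole right spine of `t` before it meets `s`. -/
lemma insertKey_appendRight {f : γ → β} {k : β} (hk : ∀ x, f x < k) (s : BinaryTree β)
    (t : BinaryTree γ) :
    insertKey k (appendRight s (t.map f)) = appendRight (insertKey k s) (t.map f) := by
  induction t with
  | nil => rfl
  | node a l r _ hr => simp [BinaryTree.map, appendRight, insertKey, (hk a).not_gt, hk a, hr]

lemma insertKey_appendLeft {f : γ → β} {k : β} (hk : ∀ x, k < f x) (s : BinaryTree β)
    (t : BinaryTree γ) :
    insertKey k (appendLeft s (t.map f)) = appendLeft (insertKey k s) (t.map f) := by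
  induction t with
  | nil => rfl
  | node a l r hl _ => simp [BinaryTree.map, appendLeft, insertKey, hk a, hl]

lemma foldl_insertKey_appendRight {f : γ → β} {w : List β} (hw : ∀ k ∈ w, ∀ x, f x < k)
    (s : BinaryTree β) (t : BinaryTree γ) :
    w.foldl (fun t k => insertKey k t) (appendRight s (t.map f)) =
      appendRight (w.foldl (fun t k => insertKey k t) s) (t.map f) := by
  induction w generalizing s with
  | nil => rfl
  | cons k w ih =>
    rw [List.foldl_cons, insertKey_appendRight (hw k List.mem_cons_self),
      ih fun k hk => hw k (List.mem_cons_of_mem _ hk), List.foldl_cons]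

lemma foldl_insertKey_appendLeft {f : γ → β} {w : List β} (hw : ∀ k ∈ w, ∀ x, k < f x)
    (s : BinaryTree β) (t : BinaryTree γ) :
    w.foldl (fun t k => insertKey k t) (appendLeft s (t.map f)) =
      appendLeft (w.foldl (fun t k => insertKey k t) s) (t.map f) := by
  induction w generalizing s with
  | nil => rfl
  | cons k w ih =>
    rw [List.foldl_cons, insertKey_appendLeft (hw k List.mem_cons_self),
      ih fun k hk => hw k (List.mem_cons_of_mem _ hk), List.foldl_cons]

lemma bstOfList_append_of_lt {f g : α → β} (hf : StrictMono f) (hg : StrictMono g)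
    (hfg : ∀ x y, f x < g y) (w : List α) :
    bstOfList (w.map f ++ w.map g) =
      appendRight ((bstOfList w).map g) ((bstOfList w).map f) := by
  have h := foldl_insertKey_appendRight (f := f) (w := w.map g)
    (by simpa using fun k _ x => hfg x k) .nil (bstOfList w)
  rw [appendRight_nil] at h
  rw [bstOfList, List.foldl_append]
  change (w.map g).foldl _ (bstOfList (w.map f)) = _
  rw [bstOfList_map hf, h]
  change appendRight (bstOfList (w.map g)) _ = _
  rw [bstOfList_map hg]

lemma bstOfList_append_of_gt {f g : α → β} (hf : StrictMono f) (hg : StrictMono g)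
    (hfg : ∀ x y, f x < g y) (w : List α) :
    bstOfList (w.map g ++ w.map f) =
      appendLeft ((bstOfList w).map f) ((bstOfList w).map g) := by
  have h := foldl_insertKey_appendLeft (f := g) (w := w.map f)
    (by simpa using fun k _ x => hfg k x) .nil (bstOfList w)
  rw [appendLeft_nil] at h
  rw [bstOfList, List.foldl_append]
  change (w.map f).foldl _ (bstOfList (w.map g)) = _
  rw [bstOfList_map hg, h]
  change appendLeft (bstOfList (w.map f)) _ = _
  rw [bstOfList_map hf]

end Insertion

/-! ### The recursive structure of simple butterfly permutations -/

/-- The Kronecker product `τ ^ k ⊗ π` for the transposition `τ` of two points. -/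
def extend {n : ℕ} (k : Fin 2) (π : Equiv.Perm (Fin (2 ^ n))) : Equiv.Perm (Fin (2 ^ (n + 1))) :=
  (finCongr (pow_succ' 2 n).symm).permCongr (kron ((Equiv.swap (0 : Fin 2) 1) ^ (k : ℕ)) π)

/-- The position `j` in the first (`c = 0`) or second (`c = 1`) half of `Fin (2 ^ (n + 1))`. -/
def half {n : ℕ} (c : Fin 2) (j : Fin (2 ^ n)) : Fin (2 ^ (n + 1)) :=
  finCongr (pow_succ' 2 n).symm (finProdFinEquiv (c, j))

section Permutations

variable {n : ℕ}

lemma val_half (c : Fin 2) (j : Fin (2 ^ n)) : (half c j : ℕ) = j + 2 ^ n * c := by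
  simp [half]

lemma half_strictMono (c : Fin 2) : StrictMono (half (n := n) c) := by
  intro i j hij
  rw [Fin.lt_def, val_half, val_half]
  exact Nat.add_lt_add_right hij _

lemma half_zero_lt_half_one (i j : Fin (2 ^ n)) : half 0 i < half 1 j := by
  rw [Fin.lt_def, val_half, val_half]
  have := i.isLt
  simp
  omega

lemma extend_half (k c : Fin 2) (π : Equiv.Perm (Fin (2 ^ n))) (j : Fin (2 ^ n)) :
    extend k π (half c j) = half (((Equiv.swap (0 : Fin 2) 1) ^ (k : ℕ)) c) (π j) := by
  simp [extend, half, kron, Equiv.permCongr_apply]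

lemma ofFn_pow_succ {α : Type*} (f : Fin (2 ^ (n + 1)) → α) :
    List.ofFn f = List.ofFn (fun j => f (half 0 j)) ++ List.ofFn (fun j => f (half 1 j)) := by
  rw [List.ofFn_congr (pow_succ' 2 n) f, List.ofFn_mul]
  simp only [List.ofFn_succ, List.ofFn_zero, List.flatten_cons, List.flatten_nil,
    List.append_nil]
  -- Both sides now list two blocks; only the values of the indices remain to be compared.
  congr 2 <;> funext j <;> congr 1 <;> ext <;> simp [val_half, add_comm, mul_comm]

lemma bst_extend_zero (π : Equiv.Perm (Fin (2 ^ n))) :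
    bst (extend 0 π) = appendRight ((bst π).map (half 1)) ((bst π).map (half 0)) := by
  rw [bst, ofFn_pow_succ, bst,
    ← bstOfList_append_of_lt (half_strictMono 0) (half_strictMono 1) half_zero_lt_half_one]
  simp [extend_half, List.map_ofFn, Function.comp_def]

lemma bst_extend_one (π : Equiv.Perm (Fin (2 ^ n))) :
    bst (extend 1 π) = appendLeft ((bst π).map (half 0)) ((bst π).map (half 1)) := by
  rw [bst, ofFn_pow_succ, bst,
    ← bstOfList_append_of_gt (half_strictMono 0) (half_strictMono 1) half_zero_lt_half_one]
  simp [extend_half, List.map_ofFn, Function.comp_def]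

lemma extend_injective (k : Fin 2) : Function.Injective (extend (n := n) k) := by
  intro π π' h
  ext j
  have h1 := DFunLike.congr_fun h (half 0 j)
  rw [extend_half, extend_half] at h1
  exact congrArg Fin.val ((half_strictMono _).injective h1)

lemma extend_zero_ne_extend_one (π π' : Equiv.Perm (Fin (2 ^ n))) : extend 0 π ≠ extend 1 π' := by
  intro h
  have h1 := DFunLike.congr_fun h (half 0 ⟨0, by positivity⟩)
  rw [extend_half, extend_half] at h1
  simp only [Fin.val_zero, pow_zero, Equiv.Perm.coe_one, id, Fin.val_one, pow_one,
    Equiv.swap_apply_left] at h1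
  exact (half_zero_lt_half_one _ _).ne h1

lemma simpleButterfly_succ :
    simpleButterfly (n + 1) = extend 0 '' simpleButterfly n ∪ extend 1 '' simpleButterfly n := by
  ext σ
  simp only [simpleButterfly, Set.mem_ofPred_eq, Fin.exists_fin_two, Set.mem_union, Set.mem_image,
    extend, eq_comm]

/-- The root of a simple butterfly tree is balanced or heavy on one side, with a Strahler number
bounded in terms of the number of factors of the permutation. -/
lemma shape_of_mem_simpleButterfly {σ : Equiv.Perm (Fin (2 ^ n))} (hσ : σ ∈ simpleButterfly n) :
    (∃ m, 2 * m ≤ n ∧ Balanced m (bst σ)) ∨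
      ∃ m, 2 * m + 1 ≤ n ∧ (RightHeavy m (bst σ) ∨ LeftHeavy m (bst σ)) := by
  induction n with
  | zero =>
    refine Or.inl ⟨0, le_rfl, ?_⟩
    have h0 : σ 0 = 0 := Fin.ext (Nat.lt_one_iff.1 (σ 0).isLt)
    have : List.ofFn σ = [0] := by simp [List.ofFn_succ, h0]
    rw [bst, this]
    exact ⟨rfl, rfl⟩
  | succ n ih =>
    rw [simpleButterfly_succ] at hσ
    obtain ⟨π, hπ, rfl⟩ | ⟨π, hπ, rfl⟩ := hσ
    · rw [bst_extend_zero]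
      obtain ⟨m, hm, h⟩ | ⟨m, hm, h | h⟩ := ih hπ
      · exact Or.inr ⟨m, by omega, Or.inl (h.appendRight _ _)⟩
      · exact Or.inr ⟨m, by omega, Or.inl (h.appendRight _ _)⟩
      · exact Or.inl ⟨m + 1, by omega, h.appendRight _ _⟩
    · rw [bst_extend_one]
      obtain ⟨m, hm, h⟩ | ⟨m, hm, h | h⟩ := ih hπ
      · exact Or.inr ⟨m, by omega, Or.inr (h.appendLeft _ _)⟩
      -- The odd bound `2 * m + 1 ≤ n` for heavy trees is what makes `2 * (m + 1) ≤ n + 1` available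
      -- here.
      · exact Or.inl ⟨m + 1, by omega, h.appendLeft _ _⟩
      · exact Or.inr ⟨m, by omega, Or.inr (h.appendLeft _ _)⟩

lemma hs_le_half {σ : Equiv.Perm (Fin (2 ^ n))} (hσ : σ ∈ simpleButterfly n) :
    hs (bst σ) ≤ n / 2 := by
  rw [hs_eq_strahler_sub_one]
  obtain ⟨m, hm, h⟩ | ⟨m, hm, h | h⟩ := shape_of_mem_simpleButterfly hσ <;>
  · rw [h.strahler_eq]
    omega

/-- The distribution of the Horton–Strahler number over the four extensions of a simple butterfly
permutation by two factors. -/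
lemma sum_hs_extend_extend {E : Type*} [AddCommMonoid E] (f : ℕ → E)
    {σ : Equiv.Perm (Fin (2 ^ n))} (hσ : σ ∈ simpleButterfly n) :
    ∑ k, ∑ k', f (hs (bst (extend k (extend k' σ)))) =
      ∑ k, f (hs (bst (extend k σ))) + 2 • f (hs (bst σ) + 1) := by
  simp only [Fin.sum_univ_two, bst_extend_zero, bst_extend_one, hs_eq_strahler_sub_one]
  obtain ⟨m, -, h⟩ | ⟨m, -, h | h⟩ := shape_of_mem_simpleButterfly hσ
  · have h0 := h.appendRight (half 0) (half 1)
    have h1 := h.appendLeft (half 1) (half 0)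
    rw [h.strahler_eq, h0.strahler_eq, h1.strahler_eq,
      (h0.appendRight (half 0) (half 1)).strahler_eq, (h0.appendLeft (half 1) (half 0)).strahler_eq,
      (h1.appendRight (half 0) (half 1)).strahler_eq, (h1.appendLeft (half 1) (half 0)).strahler_eq]
    simp only [Nat.add_sub_cancel, two_nsmul]
    abel
  · have h0 := h.appendRight (half 0) (half 1)
    have h1 := h.appendLeft (half 1) (half 0)
    rw [h.strahler_eq, h0.strahler_eq, h1.strahler_eq,
      (h0.appendRight (half 0) (half 1)).strahler_eq, (h0.appendLeft (half 1) (half 0)).strahler_eq,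
      (h1.appendRight (half 0) (half 1)).strahler_eq, (h1.appendLeft (half 1) (half 0)).strahler_eq]
    simp only [Nat.add_sub_cancel, two_nsmul]
  · have h0 := h.appendRight (half 0) (half 1)
    have h1 := h.appendLeft (half 1) (half 0)
    rw [h.strahler_eq, h0.strahler_eq, h1.strahler_eq,
      (h0.appendRight (half 0) (half 1)).strahler_eq, (h0.appendLeft (half 1) (half 0)).strahler_eq,
      (h1.appendRight (half 0) (half 1)).strahler_eq, (h1.appendLeft (half 1) (half 0)).strahler_eq]
    simp only [Nat.add_sub_cancel, two_nsmul]
    abel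

end Permutations

end Butterfly

namespace Butterfly

/-! ### Averages over the simple butterfly permutations -/

/-- The finite set of the simple butterfly permutations of length `2 ^ n`. -/
noncomputable def butterflyFinset (n : ℕ) : Finset (Equiv.Perm (Fin (2 ^ n))) :=
  (Set.toFinite (simpleButterfly n)).toFinset

/-- The expectation of a function of the Horton–Strahler number of the uniform simple butterfly
tree. -/
noncomputable def hsMean {E : Type*} [AddCommGroup E] [Module ℝ E] (n : ℕ) (f : ℕ → E) : E :=
  ((2 : ℝ) ^ n)⁻¹ • ∑ σ ∈ butterflyFinset n, f (hs (bst σ))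

lemma coe_butterflyFinset (n : ℕ) : (butterflyFinset n : Set _) = simpleButterfly n := by
  simp [butterflyFinset]

lemma mem_butterflyFinset {n : ℕ} {σ : Equiv.Perm (Fin (2 ^ n))} :
    σ ∈ butterflyFinset n ↔ σ ∈ simpleButterfly n := by
  simp [butterflyFinset]

lemma sum_butterflyFinset_zero {E : Type*} [AddCommMonoid E] (F : Equiv.Perm (Fin (2 ^ 0)) → E) :
    ∑ σ ∈ butterflyFinset 0, F σ = F 1 := by
  have : butterflyFinset 0 = {1} := by
    ext σ
    rw [mem_butterflyFinset, Finset.mem_singleton]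
    rfl
  rw [this, Finset.sum_singleton]

lemma sum_butterflyFinset_succ {E : Type*} [AddCommMonoid E] (n : ℕ)
    (F : Equiv.Perm (Fin (2 ^ (n + 1))) → E) :
    ∑ σ ∈ butterflyFinset (n + 1), F σ = ∑ σ ∈ butterflyFinset n, ∑ k, F (extend k σ) := by
  have h : butterflyFinset (n + 1) =
      (butterflyFinset n).image (extend 0) ∪ (butterflyFinset n).image (extend 1) := by
    apply Finset.coe_injective
    simp only [Finset.coe_union, Finset.coe_image, coe_butterflyFinset, simpleButterfly_succ]
  have hd : Disjoint ((butterflyFinset n).image (extend 0))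
      ((butterflyFinset n).image (extend 1)) := by
    rw [Finset.disjoint_left]
    simp only [Finset.mem_image]
    rintro _ ⟨π, -, rfl⟩ ⟨π', -, h'⟩
    exact extend_zero_ne_extend_one π π' h'.symm
  rw [h, Finset.sum_union hd, Finset.sum_image (extend_injective 0).injOn,
    Finset.sum_image (extend_injective 1).injOn, ← Finset.sum_add_distrib]
  simp only [Fin.sum_univ_two]

lemma card_butterflyFinset (n : ℕ) : (butterflyFinset n).card = 2 ^ n := by
  induction n with
  | zero => rw [Finset.card_eq_sum_ones, sum_butterflyFinset_zero, pow_zero]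
  | succ n ih =>
    rw [Finset.card_eq_sum_ones, sum_butterflyFinset_succ]
    simp [ih, pow_succ]

section Mean

variable {E : Type*} [AddCommGroup E] [Module ℝ E]

lemma hs_bst_zero (σ : Equiv.Perm (Fin (2 ^ 0))) (hσ : σ ∈ simpleButterfly 0) :
    hs (bst σ) = 0 := Nat.le_zero.1 (hs_le_half hσ)

lemma hsMean_zero (f : ℕ → E) : hsMean 0 f = f 0 := by
  rw [hsMean, sum_butterflyFinset_zero, hs_bst_zero 1 rfl]
  simp

lemma hsMean_one (f : ℕ → E) : hsMean 1 f = f 0 := by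
  have h : ∀ σ ∈ butterflyFinset 1, f (hs (bst σ)) = f 0 := fun σ hσ => by
    rw [Nat.le_zero.1 (hs_le_half (mem_butterflyFinset.1 hσ))]
  rw [hsMean, Finset.sum_congr rfl h, Finset.sum_const, card_butterflyFinset,
    ← Nat.cast_smul_eq_nsmul ℝ, smul_smul]
  simp

/-- The identity `sum_hs_extend_extend` holds for each permutation whatever its shape, so averaging
it closes the recursion without tracking the law of the shape. -/
lemma hsMean_add_two (n : ℕ) (f : ℕ → E) :
    hsMean (n + 2) f = (1 / 2 : ℝ) • (hsMean (n + 1) f + hsMean n fun j => f (j + 1)) := by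
  have h : ∑ σ ∈ butterflyFinset (n + 2), f (hs (bst σ)) =
      ∑ σ ∈ butterflyFinset (n + 1), f (hs (bst σ)) +
        (2 : ℝ) • ∑ σ ∈ butterflyFinset n, f (hs (bst σ) + 1) := by
    rw [sum_butterflyFinset_succ, sum_butterflyFinset_succ, sum_butterflyFinset_succ,
      Finset.smul_sum, ← Finset.sum_add_distrib]
    refine Finset.sum_congr rfl fun σ hσ => ?_
    rw [Finset.sum_comm, sum_hs_extend_extend f (mem_butterflyFinset.1 hσ), two_smul ℝ, two_nsmul]
  rw [hsMean, hsMean, hsMean, h]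
  simp only [smul_add, smul_smul]
  congr 2 <;> field_simp <;> ring

lemma hsMean_add (n : ℕ) (f g : ℕ → E) :
    hsMean n (fun j => f j + g j) = hsMean n f + hsMean n g := by
  simp only [hsMean, Finset.sum_add_distrib, smul_add]

lemma hsMean_const (n : ℕ) (c : E) : hsMean n (fun _ => c) = c := by
  rw [hsMean, Finset.sum_const, card_butterflyFinset, ← Nat.cast_smul_eq_nsmul ℝ, smul_smul]
  simp

lemma hsMean_mul_left {A : Type*} [Ring A] [Algebra ℝ A] (n : ℕ) (c : A) (f : ℕ → A) :
    hsMean n (fun j => c * f j) = c * hsMean n f := by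
  simp only [hsMean, ← Finset.mul_sum, mul_smul_comm]

/-- The characteristic roots of the recursion are `1` and `-1 / 2`; the shift by one in `f` acts as
a constant source term, which produces the linear growth. -/
lemma hsMean_natCast (n : ℕ) :
    hsMean n (fun j => (j : ℝ)) = n / 3 - 2 / 9 + 2 / 9 * (-1 / 2) ^ n := by
  induction n using Nat.twoStepInduction with
  | zero => norm_num [hsMean_zero]
  | one => norm_num [hsMean_one]
  | more n h0 h1 =>
    rw [hsMean_add_two, h1]
    simp only [Nat.cast_add, hsMean_add, hsMean_const, h0, smul_eq_mul]
    push_cast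
    ring

lemma hsMean_natCast_sq (n : ℕ) :
    hsMean n (fun j => (j : ℝ) ^ 2) =
      n ^ 2 / 9 - 2 / 27 * n + 2 / 27 + (8 / 27 * n - 2 / 27) * (-1 / 2) ^ n := by
  induction n using Nat.twoStepInduction with
  | zero => norm_num [hsMean_zero]
  | one => norm_num [hsMean_one]
  | more n h0 h1 =>
    have h : (fun j : ℕ => ((j + 1 : ℕ) : ℝ) ^ 2) = fun j : ℕ => (j : ℝ) ^ 2 + (2 * (j : ℝ) + 1) := by
      funext j
      push_cast
      ring
    rw [hsMean_add_two, h1, h]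
    simp only [hsMean_add, hsMean_mul_left, hsMean_const, h0, hsMean_natCast, smul_eq_mul]
    push_cast
    ring

lemma hsMean_pow_add_two (n : ℕ) (z : ℂ) :
    hsMean (n + 2) (fun j => z ^ j) =
      (hsMean (n + 1) (fun j => z ^ j) + z * hsMean n (fun j => z ^ j)) / 2 := by
  simp only [hsMean_add_two, pow_succ', hsMean_mul_left, Complex.real_smul]
  push_cast
  ring

/-- The generating function of the Horton–Strahler number of the uniform simple butterfly tree at
`z = w * (2 * w - 1)`. -/
lemma hsMean_pow {z w : ℂ} (hz : z = w * (2 * w - 1)) (hw : 4 * w - 1 ≠ 0) (n : ℕ) :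
    hsMean n (fun j => z ^ j) =
      (2 * w + 1) / (4 * w - 1) * w ^ n + (2 * w - 2) / (4 * w - 1) * (1 / 2 - w) ^ n := by
  induction n using Nat.twoStepInduction with
  | zero =>
    rw [hsMean_zero, div_mul_eq_mul_div, div_mul_eq_mul_div, ← add_div, eq_div_iff hw]
    ring
  | one =>
    rw [hsMean_one, div_mul_eq_mul_div, div_mul_eq_mul_div, ← add_div, eq_div_iff hw]
    ring
  | more n h0 h1 =>
    rw [hsMean_pow_add_two, h0, h1, hz]
    ring

end Mean

/-! ### The uniform simple butterfly tree -/

section Law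

variable {n : ℕ} {Ω : Type*} [MeasurableSpace Ω] {P : Measure Ω} {π : Ω → Equiv.Perm (Fin (2 ^ n))}

lemma integral_hs {E : Type*} [NormedAddCommGroup E] [NormedSpace ℝ E] [CompleteSpace E]
    (hπ : HasLaw π (uniformOn (simpleButterfly n)) P) (f : ℕ → E) :
    ∫ ω, f (hs (bst (π ω))) ∂P = hsMean n f := by
  have h := hπ.integral_comp (f := fun σ => f (hs (bst σ)))
    (StronglyMeasurable.of_discrete).aestronglyMeasurable
  simp only [Function.comp_def] at h
  rw [h, uniformOn, ProbabilityTheory.cond, integral_smul_measure, ← coe_butterflyFinset,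
    Measure.count_apply_finset, card_butterflyFinset, setIntegral_finset _ (.of_finite (Finset.finite_toSet _)),
    hsMean]
  simp [Measure.real]

lemma hs_le_half_ae (hπ : HasLaw π (uniformOn (simpleButterfly n)) P) :
    ∀ᵐ ω ∂P, hs (bst (π ω)) ≤ n / 2 := by
  rw [hπ.ae_iff (p := fun σ => hs (bst σ) ≤ n / 2) Measurable.of_discrete]
  filter_upwards [ae_cond_mem (DiscreteMeasurableSpace.forall_measurableSet _)] with σ hσ
  exact hs_le_half hσ

lemma aemeasurable_hs (hπ : HasLaw π (uniformOn (simpleButterfly n)) P) :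
    AEMeasurable (fun ω => (hs (bst (π ω)) : ℝ)) P :=
  (Measurable.of_discrete (f := fun σ => (hs (bst σ) : ℝ))).comp_aemeasurable hπ.aemeasurable

lemma memLp_hs [IsFiniteMeasure P] (hπ : HasLaw π (uniformOn (simpleButterfly n)) P)
    (p : ENNReal) : MemLp (fun ω => (hs (bst (π ω)) : ℝ)) p P := by
  refine MemLp.of_bound (aemeasurable_hs hπ).aestronglyMeasurable (n / 2 : ℕ) ?_
  filter_upwards [hs_le_half_ae hπ] with ω hω
  simpa using hω

lemma integral_natCast_hs (hπ : HasLaw π (uniformOn (simpleButterfly n)) P) :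
    ∫ ω, (hs (bst (π ω)) : ℝ) ∂P = n / 3 - 2 / 9 + 2 / 9 * (-1 / 2) ^ n :=
  (integral_hs hπ fun j => (j : ℝ)).trans (hsMean_natCast n)

lemma abs_neg_half_pow_le_one (n : ℕ) : |(-1 / 2 : ℝ) ^ n| ≤ 1 := by
  rw [abs_pow]
  exact pow_le_one₀ (abs_nonneg _) (by norm_num [abs_div])

lemma abs_integral_hs_sub_le (hπ : HasLaw π (uniformOn (simpleButterfly n)) P) :
    |∫ ω, (hs (bst (π ω)) : ℝ) ∂P - n / 3| ≤ 1 := by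
  rw [integral_natCast_hs hπ]
  have := abs_le.1 (abs_neg_half_pow_le_one n)
  exact abs_le.2 ⟨by linarith, by linarith⟩

variable [IsProbabilityMeasure P]

/-- The terms `n ^ 2 / 9` of the second moment and of the squared mean cancel. -/
lemma variance_hs (hπ : HasLaw π (uniformOn (simpleButterfly n)) P) :
    Var[fun ω => (hs (bst (π ω)) : ℝ); P] =
      2 / 27 * n + 2 / 81 + (4 / 27 * n + 2 / 81) * (-1 / 2) ^ n - 4 / 81 * ((-1 / 2) ^ n) ^ 2 := by
  rw [variance_eq_sub (memLp_hs hπ 2), integral_natCast_hs hπ]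
  have h := (integral_hs hπ fun j => (j : ℝ) ^ 2).trans (hsMean_natCast_sq n)
  simp only [Pi.pow_apply, h]
  ring

lemma abs_variance_hs_sub_le (hπ : HasLaw π (uniformOn (simpleButterfly n)) P) :
    |Var[fun ω => (hs (bst (π ω)) : ℝ); P] - 2 / 27 * n| ≤ 1 := by
  rw [variance_hs hπ]
  have h1 := abs_le.1 (abs_neg_half_pow_le_one n)
  -- The only error term with a growing coefficient is tamed by `n < 2 ^ n`.
  have h2 : |(n : ℝ) * (-1 / 2) ^ n| ≤ 1 := by
    rw [abs_mul, abs_pow, Nat.abs_cast, show |(-1 / 2 : ℝ)| = 2⁻¹ by norm_num [abs_div], inv_pow,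
      ← div_eq_mul_inv, div_le_one (by positivity)]
    exact_mod_cast n.lt_two_pow_self.le
  have h3 := abs_le.1 h2
  have h4 : ((-1 / 2 : ℝ) ^ n) ^ 2 ≤ 1 := (sq_le_one_iff_abs_le_one _).2 (abs_neg_half_pow_le_one n)
  have h5 := sq_nonneg ((-1 / 2 : ℝ) ^ n)
  exact abs_le.2 ⟨by linarith, by linarith⟩

end Law

end Butterfly

/-! ### Asymptotics of the characteristic function -/

namespace Butterfly

/-- A quadratic has a root whose modulus is at most the geometric mean of those of both roots. -/
lemma exists_small_root {a : ℂ} (ha : a ≠ 0) (b c : ℂ) :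
    ∃ x, a * x ^ 2 + b * x = c ∧ ‖a‖ * ‖x‖ ^ 2 ≤ ‖c‖ := by
  obtain ⟨s, hs⟩ := IsAlgClosed.exists_pow_nat_eq (b ^ 2 + 4 * a * c) two_pos
  have hxy : a * (((-b + s) / (2 * a)) * ((-b - s) / (2 * a))) = -c := by
    field_simp
    linear_combination -hs
  have hx : a * ((-b + s) / (2 * a)) ^ 2 + b * ((-b + s) / (2 * a)) = c := by
    field_simp
    linear_combination hs
  have hy : a * ((-b - s) / (2 * a)) ^ 2 + b * ((-b - s) / (2 * a)) = c := by
    field_simp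
    linear_combination hs
  have hn := congrArg norm hxy
  rw [norm_mul, norm_mul, norm_neg] at hn
  generalize (-b + s) / (2 * a) = x at *
  generalize (-b - s) / (2 * a) = y at *
  obtain h | h := le_total ‖x‖ ‖y‖
  · refine ⟨x, hx, ?_⟩
    rw [← hn, sq]
    gcongr
  · refine ⟨y, hy, ?_⟩
    rw [← hn, sq]
    gcongr

/-- If `n * θ ^ 2` converges to `c`, then `n * (exp (i θ / 3) - 1) ^ 2` converges to `-c / 9`. -/
lemma tendsto_mul_exp_sub_one_sq {θ : ℕ → ℝ} {c : ℝ} (hθ : Tendsto θ atTop (𝓝 0))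
    (hc : Tendsto (fun n : ℕ => n * θ n ^ 2) atTop (𝓝 c)) :
    Tendsto (fun n : ℕ => (n : ℂ) * (Complex.exp (Complex.I * θ n / 3) - 1) ^ 2) atTop
      (𝓝 (-(c : ℂ) / 9)) := by
  have h0 : Tendsto (fun n => Complex.I * θ n / 3) atTop (𝓝 0) := by
    have h := ((Complex.continuous_ofReal.tendsto 0).comp hθ).const_mul (Complex.I / 3)
    rw [Complex.ofReal_zero, mul_zero] at h
    refine h.congr fun n => ?_
    simp only [Function.comp_apply]
    ring
  have h1 : Tendsto (fun n => dslope Complex.exp 0 (Complex.I * θ n / 3)) atTop (𝓝 1) := by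
    have h : ContinuousAt (dslope Complex.exp 0) 0 :=
      continuousAt_dslope_same.2 Complex.differentiableAt_exp
    have h' := h.tendsto.comp h0
    rwa [dslope_same, Complex.deriv_exp, Complex.exp_zero] at h'
  have h2 : Tendsto (fun n : ℕ => ((n * θ n ^ 2 : ℝ) : ℂ)) atTop (𝓝 c) :=
    (Complex.continuous_ofReal.tendsto c).comp hc
  have h3 := (h2.mul (h1.pow 2)).mul_const (-1 / 9 : ℂ)
  rw [one_pow, mul_one, mul_div_assoc', mul_neg, mul_one] at h3
  refine h3.congr fun n => ?_
  have h4 := sub_smul_dslope Complex.exp 0 (Complex.I * θ n / 3)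
  rw [sub_zero, Complex.exp_zero, smul_eq_mul] at h4
  rw [← h4]
  push_cast
  linear_combination (-(n : ℂ) * θ n ^ 2 / 9 * dslope Complex.exp 0 (Complex.I * θ n / 3) ^ 2) *
    Complex.I_sq

end Butterfly

namespace Butterfly

/-- The characteristic function of the Horton–Strahler number of the uniform simple butterfly tree,
centered at `n / 3`, in the regime of the central limit theorem. -/
lemma tendsto_hsMean_exp {θ : ℕ → ℝ} {c : ℝ} (hθ : Tendsto θ atTop (𝓝 0))
    (hc : Tendsto (fun n : ℕ => n * θ n ^ 2) atTop (𝓝 c)) :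
    Tendsto (fun n : ℕ => Complex.exp (-(Complex.I * θ n / 3)) ^ n *
      hsMean n fun j => Complex.exp (Complex.I * θ n) ^ j) atTop
      (𝓝 (Complex.exp (-(c : ℂ) / 27))) := by
  set u : ℕ → ℂ := fun n => Complex.exp (Complex.I * θ n / 3) with hu
  have hu0 : ∀ n, u n ≠ 0 := fun n => Complex.exp_ne_zero _
  have hu_norm : ∀ n, ‖u n‖ = 1 := fun n => by
    rw [hu]
    simp only [Complex.norm_exp]
    simp
  have hu3 : ∀ n, Complex.exp (Complex.I * θ n) = u n ^ 3 := fun n => by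
    rw [hu]
    simp only [← Complex.exp_nat_mul]
    congr 1
    push_cast
    ring
  have hu_inv : ∀ n, Complex.exp (-(Complex.I * θ n / 3)) = (u n)⁻¹ := fun n => Complex.exp_neg _
  have hu1 : Tendsto u atTop (𝓝 1) := by
    have h : Continuous fun x : ℝ => Complex.exp (Complex.I * x / 3) := by fun_prop
    have h' := (h.tendsto 0).comp hθ
    simp only [Complex.ofReal_zero, mul_zero, zero_div, Complex.exp_zero] at h'
    exact h'
  -- With `z = u ^ 3` and `w = u * (1 + δ)`, the equation `z = w * (2 * w - 1)` divided by `u` is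
  -- this quadratic in `δ`. The smaller root picks the branch with `w → 1`.
  choose δ hδ hδ_norm using fun n =>
    exists_small_root (mul_ne_zero two_ne_zero (hu0 n)) (4 * u n - 1) ((u n - 1) ^ 2)
  have hδ0 : Tendsto δ atTop (𝓝 0) := by
    have h1 : Tendsto (fun n => ‖u n - 1‖) atTop (𝓝 0) := by
      simpa using (hu1.sub_const 1).norm
    refine squeeze_zero_norm (fun n => ?_) h1
    have h2 := hδ_norm n
    rw [norm_mul, hu_norm, norm_pow, mul_one, Complex.norm_ofNat] at h2
    refine (sq_le_sq₀ (norm_nonneg _) (norm_nonneg _)).1 ?_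
    nlinarith [sq_nonneg ‖δ n‖]
  have hden : Tendsto (fun n => 2 * u n * δ n + (4 * u n - 1)) atTop (𝓝 3) := by
    have h := ((hu1.const_mul 2).mul hδ0).add ((hu1.const_mul 4).sub_const 1)
    norm_num at h
    exact h
  -- Factoring `δ` out of the quadratic gives `δ = (u - 1) ^ 2 / (2 * u * δ + 4 * u - 1)`, whose
  -- denominator tends to 3.
  have hnδ : Tendsto (fun n : ℕ => n * δ n) atTop (𝓝 (-(c : ℂ) / 27)) := by
    have h := (tendsto_mul_exp_sub_one_sq hθ hc).div hden three_ne_zero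
    rw [div_div, show (9 : ℂ) * 3 = 27 by norm_num] at h
    refine h.congr' ?_
    filter_upwards [hden.eventually_ne three_ne_zero] with n hn
    rw [Pi.div_apply, div_eq_iff hn]
    change (n : ℂ) * (u n - 1) ^ 2 = _
    rw [← hδ n]
    ring
  have hpow := Complex.tendsto_one_add_pow_exp_of_tendsto hnδ
  have hw1 : Tendsto (fun n => u n * (1 + δ n)) atTop (𝓝 1) := by
    simpa using hu1.mul (hδ0.const_add 1)
  have hw4 : Tendsto (fun n => 4 * (u n * (1 + δ n)) - 1) atTop (𝓝 3) := by
    have h := (hw1.const_mul 4).sub_const 1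
    norm_num at h
    exact h
  have hC1 : Tendsto (fun n => (2 * (u n * (1 + δ n)) + 1) / (4 * (u n * (1 + δ n)) - 1)) atTop
      (𝓝 1) := by
    have h := ((hw1.const_mul 2).add_const 1).div hw4 three_ne_zero
    norm_num at h
    exact h
  have hC2 : Tendsto (fun n => (2 * (u n * (1 + δ n)) - 2) / (4 * (u n * (1 + δ n)) - 1)) atTop
      (𝓝 0) := by
    have h := ((hw1.const_mul 2).sub_const 2).div hw4 three_ne_zero
    norm_num at h
    exact h
  -- The modulus tends to `1 / 2`; the bound 1 suffices because the coefficient of this root already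
  -- tends to 0.
  have hr : ∀ᶠ n in atTop, ‖(1 / 2 - u n * (1 + δ n)) * (u n)⁻¹‖ ≤ 1 := by
    have h := ((hw1.const_sub (1 / 2)).mul (hu1.inv₀ one_ne_zero)).norm
    refine (h.eventually_lt_const (u := 1) ?_).mono fun n hn => hn.le
    norm_num
  have hsecond : Tendsto (fun n => (2 * (u n * (1 + δ n)) - 2) / (4 * (u n * (1 + δ n)) - 1) *
      ((1 / 2 - u n * (1 + δ n)) * (u n)⁻¹) ^ n) atTop (𝓝 0) := by
    refine squeeze_zero_norm' ?_ (tendsto_zero_iff_norm_tendsto_zero.1 hC2)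
    filter_upwards [hr] with n hn
    rw [norm_mul, norm_pow]
    exact mul_le_of_le_one_right (norm_nonneg _) (pow_le_one₀ (norm_nonneg _) hn)
  have hfinal := (hC1.mul hpow).add hsecond
  rw [one_mul, add_zero] at hfinal
  refine hfinal.congr' ?_
  filter_upwards [hw4.eventually_ne three_ne_zero] with n hn
  have hz : u n ^ 3 = u n * (1 + δ n) * (2 * (u n * (1 + δ n)) - 1) := by
    linear_combination -u n * hδ n
  rw [hu_inv, hu3, hsMean_pow hz hn, mul_pow, mul_pow, inv_pow]
  have := pow_ne_zero n (hu0 n)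
  field_simp

/-! ### Moment bounds for the normalized number -/

section Law

variable {n : ℕ} {Ω : Type*} [MeasurableSpace Ω] {P : Measure Ω} [IsProbabilityMeasure P]
  {π : Ω → Equiv.Perm (Fin (2 ^ n))}

/-- Variance plus squared bias is at most `2 / 27 * n + 2`; multiplied by `9 / n ^ 2` this is at
most `19 / n` once `n ≥ 1`. -/
lemma integral_sq_hs_div_sub_one_le (hn : 0 < n)
    (hπ : HasLaw π (uniformOn (simpleButterfly n)) P) :
    ∫ ω, ((hs (bst (π ω)) : ℝ) / (n / 3) - 1) ^ 2 ∂P ≤ 19 / (n : ℝ) := by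
  have hn' : (1 : ℝ) ≤ n := by exact_mod_cast hn
  have hX := memLp_hs hπ 2
  have h1 : ∀ ω, ((hs (bst (π ω)) : ℝ) / (n / 3) - 1) ^ 2 =
      9 / n ^ 2 * ((hs (bst (π ω)) : ℝ) - n / 3) ^ 2 := fun ω => by
    field_simp
    ring
  have h2 : ∫ ω, ((hs (bst (π ω)) : ℝ) - n / 3) ^ 2 ∂P =
      Var[fun ω => (hs (bst (π ω)) : ℝ); P] + (∫ ω, (hs (bst (π ω)) : ℝ) ∂P - n / 3) ^ 2 := by
    have h3 := variance_eq_sub (hX.sub (memLp_const ((n : ℝ) / 3)))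
    have h4 := variance_sub_const hX.aestronglyMeasurable ((n : ℝ) / 3)
    have h5 : ∫ ω, ((hs (bst (π ω)) : ℝ) - n / 3) ∂P = ∫ ω, (hs (bst (π ω)) : ℝ) ∂P - n / 3 := by
      rw [integral_sub (hX.integrable one_le_two) (integrable_const _)]
      simp
    rw [← h4, ← h5]
    change Var[fun ω => (hs (bst (π ω)) : ℝ) - n / 3; P] =
      ∫ ω, ((hs (bst (π ω)) : ℝ) - n / 3) ^ 2 ∂P - (∫ ω, ((hs (bst (π ω)) : ℝ) - n / 3) ∂P) ^ 2 at h3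
    rw [h3]
    ring
  simp only [h1]
  rw [integral_const_mul, h2]
  have h3 := (abs_le.1 (abs_variance_hs_sub_le hπ)).2
  have h4 := (sq_le_one_iff_abs_le_one _).2 (abs_integral_hs_sub_le hπ)
  rw [div_mul_eq_mul_div, div_le_div_iff₀ (by positivity) (by positivity)]
  have h5 : 9 * (Var[fun ω => (hs (bst (π ω)) : ℝ); P] +
      (∫ ω, (hs (bst (π ω)) : ℝ) ∂P - n / 3) ^ 2) ≤ 19 * n := by linarith
  rw [sq (n : ℝ), ← mul_assoc]
  exact mul_le_mul_of_nonneg_right h5 (by positivity)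

/-- By the bound `n / 2` the normalized deviation lies in `[-1, 1 / 2]`, so its powers of exponent
`r ≥ 2` are dominated by its square. -/
lemma eLpNorm_hs_div_sub_one_le (hn : 0 < n) (hπ : HasLaw π (uniformOn (simpleButterfly n)) P)
    {r : ℝ} (hr : 2 ≤ r) :
    eLpNorm (fun ω => (hs (bst (π ω)) : ℝ) / (n / 3) - 1) (ENNReal.ofReal r) P ≤
      ENNReal.ofReal ((19 / n) ^ r⁻¹) := by
  have hn' : (1 : ℝ) ≤ n := by exact_mod_cast hn
  have hr0 : 0 < r := by linarith
  have hY : ∀ p, MemLp (fun ω => (hs (bst (π ω)) : ℝ) / (n / 3) - 1) p P := fun p => by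
    simp only [div_eq_mul_inv]
    exact ((memLp_hs hπ p).mul_const _).sub (memLp_const 1)
  rw [(hY _).eLpNorm_eq_integral_rpow_norm (by simpa using hr0) ENNReal.ofReal_ne_top,
    ENNReal.toReal_ofReal hr0.le]
  refine ENNReal.ofReal_le_ofReal (Real.rpow_le_rpow ?_ ?_ (by positivity))
  · exact integral_nonneg fun ω => by positivity
  · refine le_trans (integral_mono_ae ?_ (hY 2).integrable_sq ?_)
      (integral_sq_hs_div_sub_one_le hn hπ)
    · have := (hY (ENNReal.ofReal r)).integrable_norm_rpow (by simpa using hr0)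
        ENNReal.ofReal_ne_top
      rwa [ENNReal.toReal_ofReal hr0.le] at this
    · filter_upwards [hs_le_half_ae hπ] with ω hω
      have h1 : (2 * hs (bst (π ω)) : ℝ) ≤ n := by
        have : 2 * hs (bst (π ω)) ≤ n := by omega
        exact_mod_cast this
      have h2 : ‖(hs (bst (π ω)) : ℝ) / (n / 3) - 1‖ ≤ 1 := by
        rw [Real.norm_eq_abs, abs_le]
        constructor
        · linarith [show 0 ≤ (hs (bst (π ω)) : ℝ) / (n / 3) by positivity]
        · rw [sub_le_iff_le_add, div_le_iff₀ (by positivity)]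
          linarith
      calc ‖(hs (bst (π ω)) : ℝ) / (n / 3) - 1‖ ^ r
          ≤ ‖(hs (bst (π ω)) : ℝ) / (n / 3) - 1‖ ^ (2 : ℝ) :=
            Real.rpow_le_rpow_of_exponent_ge' (norm_nonneg _) h2 zero_le_two hr
        _ = ((hs (bst (π ω)) : ℝ) / (n / 3) - 1) ^ 2 := by
            rw [Real.rpow_two, Real.norm_eq_abs, sq_abs]

end Law

/-! ### Limit theorems -/

section Sequence

variable {Ω : ℕ → Type*} [∀ n, MeasurableSpace (Ω n)] {P : ∀ n, Measure (Ω n)}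
  [∀ n, IsProbabilityMeasure (P n)] {π : ∀ n, Ω n → Equiv.Perm (Fin (2 ^ n))}

lemma tendsto_eLpNorm_hs_div_sub_one
    (hπ : ∀ n, HasLaw (π n) (uniformOn (simpleButterfly n)) (P n)) (r : ℝ) :
    Tendsto (fun n : ℕ => eLpNorm (fun ω => (hs (bst (π n ω)) : ℝ) / (n / 3) - 1)
      (ENNReal.ofReal r) (P n)) atTop (𝓝 0) := by
  -- Exponents below 2 reduce to 2, since `L ^ p` norms increase with `p` on a probability space.
  have h2 : 2 ≤ max r 2 := le_max_right _ _
  have hlim : Tendsto (fun n : ℕ => ENNReal.ofReal ((19 / (n : ℝ)) ^ (max r 2)⁻¹)) atTop (𝓝 0) := by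
    have h := (tendsto_const_div_atTop_nhds_zero_nat (19 : ℝ)).rpow_const
      (p := (max r 2)⁻¹) (Or.inr (by positivity))
    rw [Real.zero_rpow (by positivity)] at h
    simpa using ENNReal.tendsto_ofReal h
  refine tendsto_of_tendsto_of_tendsto_of_le_of_le' tendsto_const_nhds hlim
    (Eventually.of_forall fun _ => zero_le) ?_
  filter_upwards [eventually_gt_atTop 0] with n hn
  refine le_trans ?_ (eLpNorm_hs_div_sub_one_le hn (hπ n) h2)
  refine eLpNorm_le_eLpNorm_of_exponent_le (ENNReal.ofReal_le_ofReal (le_max_left _ _)) ?_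
  exact (((aemeasurable_hs (hπ n)).div_const _).sub_const 1).aestronglyMeasurable

lemma tendsto_measure_hs_div_sub_one
    (hπ : ∀ n, HasLaw (π n) (uniformOn (simpleButterfly n)) (P n)) {ε : ℝ} (hε : 0 < ε) :
    Tendsto (fun n : ℕ => P n {ω | ε ≤ |(hs (bst (π n ω)) : ℝ) / (n / 3) - 1|}) atTop (𝓝 0) := by
  have h := ENNReal.Tendsto.const_mul (a := (ENNReal.ofReal ε)⁻¹)
    (tendsto_eLpNorm_hs_div_sub_one hπ 1) (Or.inr (by simpa using hε))
  rw [mul_zero] at h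
  refine tendsto_of_tendsto_of_tendsto_of_le_of_le tendsto_const_nhds h
    (fun _ => zero_le) fun n => ?_
  -- Markov's inequality for the first absolute moment.
  have h1 := meas_ge_le_mul_pow_eLpNorm_enorm (P n) (p := 1) one_ne_zero ENNReal.one_ne_top
    (((aemeasurable_hs (hπ n)).div_const ((n : ℝ) / 3)).sub_const 1).aestronglyMeasurable
    (ε := ENNReal.ofReal ε) (by simpa using hε) (by simp)
  simp only [ENNReal.toReal_one, ENNReal.rpow_one] at h1
  rw [ENNReal.ofReal_one]
  refine le_trans (measure_mono fun ω hω => ?_) h1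
  simp only [Set.mem_ofPred_eq] at hω ⊢
  rw [Real.enorm_eq_ofReal_abs]
  exact ENNReal.ofReal_le_ofReal hω

/-- The central limit theorem for the Horton–Strahler number of uniform simple butterfly trees. -/
lemma tendstoInDistribution_hs
    (hπ : ∀ n, HasLaw (π n) (uniformOn (simpleButterfly n)) (P n)) :
    TendstoInDistribution
      (fun n ω => ((hs (bst (π n ω)) : ℝ) - ∫ ω', (hs (bst (π n ω')) : ℝ) ∂P n) /
        √Var[fun ω' => (hs (bst (π n ω')) : ℝ); P n]) atTop
      (id : ℝ → ℝ) P (gaussianReal 0 1) := by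
  have hX := fun n => aemeasurable_hs (hπ n)
  have hm : ∀ n, AEMeasurable (fun ω => ((hs (bst (π n ω)) : ℝ) -
      ∫ ω', (hs (bst (π n ω')) : ℝ) ∂P n) / √Var[fun ω' => (hs (bst (π n ω')) : ℝ); P n]) (P n) :=
    fun n => ((hX n).sub_const _).div_const _
  refine ⟨hm, aemeasurable_id, ProbabilityMeasure.tendsto_iff_tendsto_charFun.2 fun t => ?_⟩
  simp only [ProbabilityMeasure.coe_mk, Measure.map_id, charFun_gaussianReal]
  set e : ℕ → ℝ := fun n => ∫ ω', (hs (bst (π n ω')) : ℝ) ∂P n with he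
  set v : ℕ → ℝ := fun n => Var[fun ω' => (hs (bst (π n ω')) : ℝ); P n] with hv
  have hv_le : ∀ n : ℕ, |v n - 2 / 27 * n| ≤ 1 := fun n => abs_variance_hs_sub_le (hπ n)
  have he_le : ∀ n : ℕ, |e n - n / 3| ≤ 1 := fun n => abs_integral_hs_sub_le (hπ n)
  have hv_div : Tendsto (fun n : ℕ => v n / n) atTop (𝓝 (2 / 27)) := by
    rw [tendsto_iff_norm_sub_tendsto_zero]
    refine squeeze_zero' (Eventually.of_forall fun _ => norm_nonneg _) ?_
      tendsto_one_div_atTop_nhds_zero_nat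
    filter_upwards [eventually_gt_atTop 0] with n hn
    have hn' : (0 : ℝ) < n := by exact_mod_cast hn
    rw [Real.norm_eq_abs, show v n / n - 2 / 27 = (v n - 2 / 27 * n) / n by field_simp, abs_div,
      abs_of_pos hn']
    exact div_le_div_of_nonneg_right (hv_le n) hn'.le
  -- The frequency is `θ = t / √v` with `v` of order `2 / 27 * n`; the limit `c = 27 / 2 * t ^ 2`
  -- turns `exp (-c / 27)` into `exp (-t ^ 2 / 2)`.
  have hc : Tendsto (fun n : ℕ => n * (t / √(v n)) ^ 2) atTop (𝓝 (27 / 2 * t ^ 2)) := by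
    have h := (hv_div.inv₀ (by norm_num)).mul_const (t ^ 2)
    rw [inv_div] at h
    refine h.congr fun n => ?_
    rw [div_pow, Real.sq_sqrt (variance_nonneg _ _), inv_div]
    ring
  have hθ : Tendsto (fun n : ℕ => t / √(v n)) atTop (𝓝 0) := by
    have h := hc.mul (tendsto_one_div_atTop_nhds_zero_nat (𝕜 := ℝ))
    rw [mul_zero] at h
    rw [tendsto_zero_iff_norm_tendsto_zero]
    have h' := h.sqrt
    rw [Real.sqrt_zero] at h'
    refine h'.congr' ?_
    filter_upwards [eventually_gt_atTop 0] with n hn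
    have hn' : (n : ℝ) ≠ 0 := by exact_mod_cast hn.ne'
    rw [mul_one_div, mul_div_cancel_left₀ _ hn', Real.sqrt_sq_eq_abs, Real.norm_eq_abs]
  -- Centering at the mean instead of `n / 3` costs a phase: a bounded shift times a vanishing
  -- frequency.
  have hdrift : Tendsto (fun n : ℕ => Complex.exp (-(Complex.I * ((t / √(v n)) * (e n - n / 3) : ℝ))))
      atTop (𝓝 1) := by
    have h : Tendsto (fun n : ℕ => (t / √(v n)) * (e n - n / 3)) atTop (𝓝 0) := by
      refine squeeze_zero_norm (fun n => ?_) (tendsto_zero_iff_norm_tendsto_zero.1 hθ)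
      rw [norm_mul]
      exact mul_le_of_le_one_right (norm_nonneg _) (he_le n)
    have hcont : Continuous fun x : ℝ => Complex.exp (-(Complex.I * x)) := by fun_prop
    have h' := (hcont.tendsto 0).comp h
    simp only [Complex.ofReal_zero, mul_zero, neg_zero, Complex.exp_zero] at h'
    exact h'
  have hlim := hdrift.mul (tendsto_hsMean_exp hθ hc)
  rw [one_mul] at hlim
  have hgoal : Complex.exp (t * ((0 : ℝ) : ℂ) * Complex.I - ((1 : NNReal) : ℝ) * t ^ 2 / 2) =
      Complex.exp (-((27 / 2 * t ^ 2 : ℝ) : ℂ) / 27) := by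
    congr 1
    push_cast
    ring
  rw [hgoal]
  refine hlim.congr fun n => ?_
  rw [charFun_apply_real, integral_map (hm n) (by fun_prop), ← integral_hs (hπ n),
    ← integral_const_mul, ← integral_const_mul]
  refine integral_congr_ae (Eventually.of_forall fun ω => ?_)
  simp only [← Complex.exp_nat_mul, ← Complex.exp_add]
  congr 1
  push_cast
  ring

end Sequence

end Butterfly

theorem theorem2 {Ω : ℕ → Type*} [∀ n, MeasurableSpace (Ω n)] (P : ∀ n, Measure (Ω n))
    [∀ n, IsProbabilityMeasure (P n)]
    -- a uniform simple butterfly permutation of length `N = 2 ^ n`, for every `n`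
    (π : ∀ n, Ω n → Equiv.Perm (Fin (2 ^ n)))
    (hπ : ∀ n, HasLaw (π n) (uniformOn (Butterfly.simpleButterfly n)) (P n))
    -- the Horton–Strahler number of the corresponding uniform simple butterfly tree
    (H : ∀ n, Ω n → ℝ)
    (hH : ∀ n ω, H n ω = (Butterfly.hs (Butterfly.bst (π n ω)) : ℝ)) :
    -- the deterministic bound, for every simple butterfly tree
    (∀ (n : ℕ), ∀ σ ∈ Butterfly.simpleButterfly n,
      Butterfly.hs (Butterfly.bst σ) ≤ ⌊Real.logb 4 ((2 : ℝ) ^ n)⌋₊) ∧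
    -- mean and variance
    (∃ C : ℝ, ∀ n, |(P n)[H n] - Real.logb 8 ((2 : ℝ) ^ n)| ≤ C) ∧
    (∃ C : ℝ, ∀ n, |Var[H n; P n] - 2 / 9 * Real.logb 8 ((2 : ℝ) ^ n)| ≤ C) ∧
    -- convergence in probability
    (∀ ε : ℝ, 0 < ε → Tendsto
      (fun n => P n {ω | ε ≤ |H n ω / Real.logb 8 ((2 : ℝ) ^ n) - 1|}) atTop (𝓝 0)) ∧
    -- convergence in `L ^ r`
    (∀ r : ℝ, 1 ≤ r → Tendsto
      (fun n => eLpNorm (fun ω => H n ω / Real.logb 8 ((2 : ℝ) ^ n) - 1)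
        (ENNReal.ofReal r) (P n)) atTop (𝓝 0)) ∧
    -- central limit theorem
    TendstoInDistribution
      (fun n ω => (H n ω - (P n)[H n]) / Real.sqrt (Var[H n; P n])) atTop
      (id : ℝ → ℝ) P (gaussianReal 0 1) := by
  have hlog (b : ℝ) (k : ℕ) (hk : 0 < k) (hb : b = 2 ^ k) (n : ℕ) :
      Real.logb b ((2 : ℝ) ^ n) = n / k := by
    have : Real.log 2 ≠ 0 := (Real.log_pos one_lt_two).ne'
    rw [Real.logb, hb, Real.log_pow, Real.log_pow, mul_div_mul_right _ _ this]
  have hlog8 (n : ℕ) : Real.logb 8 ((2 : ℝ) ^ n) = n / 3 := by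
    rw [hlog 8 3 (by norm_num) (by norm_num), Nat.cast_ofNat]
  obtain rfl : H = fun n ω => (Butterfly.hs (Butterfly.bst (π n ω)) : ℝ) :=
    funext fun n => funext (hH n)
  simp only [hlog8]
  refine ⟨fun n σ hσ => ?_, ⟨1, fun n => Butterfly.abs_integral_hs_sub_le (hπ n)⟩, ⟨1, fun n => ?_⟩,
    fun ε hε => Butterfly.tendsto_measure_hs_div_sub_one hπ hε,
    fun r _ => Butterfly.tendsto_eLpNorm_hs_div_sub_one hπ r, Butterfly.tendstoInDistribution_hs hπ⟩
  · rw [hlog 4 2 two_pos (by norm_num), Nat.floor_div_natCast, Nat.floor_natCast]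
    exact Butterfly.hs_le_half hσ
  · rw [show 2 / 9 * ((n : ℝ) / 3) = 2 / 27 * n by ring]
    exact Butterfly.abs_variance_hs_sub_le (hπ n)
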